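/- Let $F_2=\langle a,b\rangle$ be the free group of rank $2$. A pair $(u,v)$ is a generator pair if $u,v$ generate $F_2$, and $u$ is primitive if it belongs to a generator pair. Let $\mathcal E=\{0/1,1/0,1/1\}$. For $u\in F_2$ let $e_a(u),e_b(u)\in\mathbb Z$ be the exponent sums of $a$ and $b$; a primitive $u$ has type $\eta\in\mathcal E$ if the fraction $e_b(u)/e_a(u)$, with numerator and denominator reduced mod $2$, is $\eta$ (so $a,b,ab$ have types $0/1,1/0,1/1$). A generator pair $(u,v)$ has type $(\eta,\eta')$ if $u$ has type $\eta$ and $v$ has type $\eta'$. For $\eta\ne\eta'$ the basic generator pair of type $(\eta,\eta')$ consists of the two elements of $\{a,b,ab\}$ of types $\eta$ and $\eta'$, and an element is palindromic with respect to $(\eta,\eta')$ if, written as a reduced word in the elements of this basic pair and their inverses, it reads the same forwards and backwards. An element is cyclically shortest if its word, together with all its cyclic permutations, is reduced; here the word may be taken either in $a^{\pm1},b^{\pm1}$, or in the basic pair of type $(\eta,\eta')$ and its inverses, and the statement holds for each choice. A pair has one of these properties if both of its elements do. (1) Let $u\in F_2$ be primitive of type $\eta$ and let $\eta'\neq\eta$.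 Then there is a conjugate $u'$ of $u$ that is cyclically shortest and palindromic with respect to $(\eta,\eta')$, and every conjugate of $u$ or of $u^{-1}$ with these two properties is $u'$ or $u'^{-1}$. (2) Let $(u,v)$ be a generator pair of type $(\eta,\eta')$. Then there is $g\in F_2$ such that the pair $(u',v')=(gug^{-1},gvg^{-1})$ is cyclically shortest and palindromic with respect to $(\eta,\eta')$; and for all signs $\epsilon,\delta\in\{1,-1\}$ and $h\in F_2$, if the pair $(w,z)=(hu^{\epsilon}h^{-1},hv^{\delta}h^{-1})$ has these two properties, then $w\in\{u',u'^{-1}\}$ and $z\in\{v',v'^{-1}\}$. -/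

import Mathlib

namespace PalindromicPrimitives

/-- The free group `F₂ = ⟨a, b⟩`. -/
abbrev F2 : Type := FreeGroup (Fin 2)

/-- The fixed generator `a`. -/
def a : F2 := FreeGroup.of 0

/-- The fixed generator `b`. -/
def b : F2 := FreeGroup.of 1

/-- `(u, v)` is a generator pair of `F₂`: the elements `u` and `v` generate `F₂`. -/
def IsGeneratorPair (u v : F2) : Prop := Subgroup.closure {u, v} = ⊤

/-- `u` is primitive: it is one element of a generator pair. -/
def IsPrimitive (u : F2) : Prop := ∃ v : F2, IsGeneratorPair u v

/-- The exponent sum of the `i`-th generator (`0` for `a`, `1` for `b`) in an element of `F₂`. -/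
def expSum (i : Fin 2) (u : F2) : ℤ :=
  Multiplicative.toAdd
    (FreeGroup.lift (fun j : Fin 2 => Multiplicative.ofAdd (if j = i then (1 : ℤ) else 0)) u)

/-- The three mod 2 classes `0/1`, `1/0`, `1/1` of extended rationals. -/
inductive Mod2Type : Type
  | zeroOne : Mod2Type
  | oneZero : Mod2Type
  | oneOne : Mod2Type

/-- The residues `(p mod 2, q mod 2)` of a fraction `p/q` in the given class. -/
def Mod2Type.residues : Mod2Type → ZMod 2 × ZMod 2
  | .zeroOne => (0, 1)
  | .oneZero => (1, 0)
  | .oneOne => (1, 1)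

/-- The element of the triple `a, b, ab` identified with `0/1, 1/0, 1/1` respectively. -/
def Mod2Type.generator : Mod2Type → F2
  | .zeroOne => a
  | .oneZero => b
  | .oneOne => a * b

/-- The element `u` is of type `η`. A primitive `u` lies in the extended conjugacy class labelled
by the fraction `p/q` with `p` the exponent sum of `b` and `q` the exponent sum of `a` (so that `a`
has label `0/1` and `b` has label `1/0`). For primitive `u` these exponent sums are coprime, so the
mod 2 class of `p/q` is read off from their residues. -/
def HasType (u : F2) (η : Mod2Type) : Prop :=
  ((expSum 1 u : ZMod 2), (expSum 0 u : ZMod 2)) = η.residues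

/-- The pair `(a, b)`. -/
def standardPair : F2 × F2 := (a, b)

/-- The basic generator pair corresponding to `(η, η')`, for `η ≠ η'`: one of
`(a, b)`, `(a, ab)`, `(b, ab)`, up to the order of its two elements. -/
def basicPair (η η' : Mod2Type) : F2 × F2 := (η.generator, η'.generator)

/-- The element of `F₂` spelled by a word in two letters when these are replaced by the elements of
the pair `P`. -/
def evalIn (P : F2 × F2) : FreeGroup (Fin 2) →* F2 := FreeGroup.lift ![P.1, P.2]

/-- The element `w`, written as a reduced word in the elements of the pair `P` and their inverses,
reads the same forwards and backwards. -/
def IsPalindromicIn (P : F2 × F2) (w : F2) : Prop :=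
  ∃ x : FreeGroup (Fin 2), evalIn P x = w ∧ x.toWord.reverse = x.toWord

/-- The element `w`, written as a word in the elements of the pair `P` and their inverses, is
reduced together with all its cyclic permutations. -/
def IsCyclicallyShortestIn (P : F2 × F2) (w : F2) : Prop :=
  ∃ x : FreeGroup (Fin 2), evalIn P x = w ∧ FreeGroup.IsCyclicallyReduced x.toWord

end PalindromicPrimitives

/-! Let `rev` be the anti-automorphism fixing `a` and `b`. For distinct types, conjugating `rev` by
a suitable `m = middle η η'` in `{1, a, b⁻¹}` gives the anti-automorphism fixing both elements of
the basic pair. Hence `w` is palindromic for that pair exactly when `w * m = m * rev w`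
(`isPalindromicIn_basicPair_iff`).

Existence: by Nielsen induction, every generator pair `(u, v)` has a `g` with `rev g = g`, `u * g =
g * rev u` and `v * g = g * rev v`, whose parity is determined by those of `u` and `v`
(`exists_reversing_element`). Writing the palindrome `g` as `h * m * rev h` and conjugating the pair
by `h⁻¹` leaves `m` as reversing element, and parity forces `m = middle η η'`. Cyclic shortness is
then automatic.

Uniqueness: if `x` and `y * x * y⁻¹` are palindromes, then `rev y * y` commutes with `x`. For
primitive `x` it is therefore a power of `x`, and counting exponents mod 2 makes it an even power `x
^ (l + l)`. Then `y * x ^ (-l)` is inverted by `rev`, so it is trivial and `y` commutes with `x`. -/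

namespace PalindromicPrimitives

open FreeGroup

/-! ### Cancellation in products of reduced words -/

section CommonPrefix

variable {α : Type*} [DecidableEq α]

/-- The length of the longest common prefix of two lists. -/
def commonPrefixLength {β : Type*} [DecidableEq β] : List β → List β → ℕ
  | [], _ => 0
  | _ :: _, [] => 0
  | x :: xs, y :: ys => if x = y then commonPrefixLength xs ys + 1 else 0

theorem commonPrefixLength_comm {β : Type*} [DecidableEq β] (l₁ l₂ : List β) :
    commonPrefixLength l₁ l₂ = commonPrefixLength l₂ l₁ := by
  induction l₁ generalizing l₂ with
  | nil => cases l₂ <;> simp [commonPrefixLength]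
  | cons x xs ih =>
    cases l₂ with
    | nil => simp [commonPrefixLength]
    | cons y ys => simp only [commonPrefixLength, ih ys, eq_comm]

theorem le_commonPrefixLength_iff {β : Type*} [DecidableEq β] (k : ℕ) (l₁ l₂ : List β) :
    k ≤ commonPrefixLength l₁ l₂ ↔
      k ≤ l₁.length ∧ k ≤ l₂.length ∧ l₁.take k = l₂.take k := by
  induction l₁ generalizing l₂ k with
  | nil => cases k <;> simp [commonPrefixLength]
  | cons x xs ih =>
    cases l₂ with
    | nil => cases k <;> simp [commonPrefixLength]
    | cons y ys =>
      cases k with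
      | zero => simp
      | succ k =>
        by_cases h : x = y
        · simp [commonPrefixLength, h, ih]
        · simp [commonPrefixLength, h]

theorem min_commonPrefixLength_le {β : Type*} [DecidableEq β] (l₁ l₂ l₃ : List β) :
    min (commonPrefixLength l₁ l₂) (commonPrefixLength l₂ l₃) ≤ commonPrefixLength l₁ l₃ := by
  rw [le_commonPrefixLength_iff]
  obtain ⟨h₁, -, h₂⟩ := (le_commonPrefixLength_iff _ l₁ l₂).1
    (min_le_left (commonPrefixLength l₁ l₂) (commonPrefixLength l₂ l₃))
  obtain ⟨-, h₃, h₄⟩ := (le_commonPrefixLength_iff _ l₂ l₃).1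
    (min_le_right (commonPrefixLength l₁ l₂) (commonPrefixLength l₂ l₃))
  exact ⟨h₁, h₃, h₂.trans h₄⟩

/-- The length of the longest common prefix of the reduced words of two elements. -/
def cancellation (x y : FreeGroup α) : ℕ := commonPrefixLength x.toWord y.toWord

theorem cancellation_comm (x y : FreeGroup α) : cancellation x y = cancellation y x :=
  commonPrefixLength_comm _ _

/-- The ultrametric inequality for common prefixes; it replaces tracking subwords in the Nielsen
arguments. -/
theorem min_cancellation_le (x y z : FreeGroup α) :
    min (cancellation x y) (cancellation y z) ≤ cancellation x z :=
  min_commonPrefixLength_le _ _ _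

theorem isReduced_invRev {L : List (α × Bool)} (h : IsReduced L) : IsReduced (invRev L) := by
  rw [isReduced_iff_reduce_eq] at h ⊢
  rw [reduce_invRev, h]

theorem norm_inv_mk_mul_mk (L₁ L₂ : List (α × Bool)) (h₁ : IsReduced L₁) (h₂ : IsReduced L₂) :
    norm ((mk L₁)⁻¹ * mk L₂) + 2 * commonPrefixLength L₁ L₂ = L₁.length + L₂.length := by
  induction L₁ generalizing L₂ with
  | nil =>
    have : (mk ([] : List (α × Bool)))⁻¹ * mk L₂ = mk L₂ := by rw [← one_eq_mk]; simp
    rw [this, FreeGroup.norm, toWord_mk, h₂.reduce_eq]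
    simp [commonPrefixLength]
  | cons x xs ih =>
    cases L₂ with
    | nil =>
      rw [← one_eq_mk, mul_one, norm_inv_eq, FreeGroup.norm, toWord_mk, h₁.reduce_eq]
      simp [commonPrefixLength]
    | cons y ys =>
      by_cases h : x = y
      · subst h
        have e : (mk (x :: xs))⁻¹ * mk (x :: ys) = (mk xs)⁻¹ * mk ys := by
          rw [← List.singleton_append, ← List.singleton_append (l := ys), ← mul_mk, ← mul_mk]
          group
        have := ih ys (h₁.infix ⟨[x], [], by simp⟩) (h₂.infix ⟨[x], [], by simp⟩)
        rw [e]
        simp only [commonPrefixLength, if_true, List.length_cons]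
        omega
      · have hr : IsReduced (invRev (x :: xs) ++ y :: ys) := by
          have h₁' := isReduced_invRev h₁
          refine List.isChain_append.2 ?_
          refine ⟨h₁', h₂, ?_⟩
          intro p hp q hq
          rw [invRev_cons] at hp
          simp [invRev] at hp hq
          subst hp hq
          rintro h'
          by_contra hb
          apply h
          ext
          · exact h'
          · revert hb; simp
        rw [inv_mk, mul_mk, FreeGroup.norm, toWord_mk, hr.reduce_eq]
        simp [commonPrefixLength, h, invRev_length]

theorem norm_inv_mul (x y : FreeGroup α) :
    norm (x⁻¹ * y) + 2 * cancellation x y = norm x + norm y := by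
  have := norm_inv_mk_mul_mk x.toWord y.toWord isReduced_toWord isReduced_toWord
  rwa [mk_toWord, mk_toWord] at this

/-- With `x = c * r * c⁻¹` and `r` cyclically reduced and nonempty, the reduced word of `x * x` is
that of `c * r * r * c⁻¹`. -/
theorem norm_lt_norm_mul_self {x : FreeGroup α} (hx : x ≠ 1) : norm x < norm (x * x) := by
  have h := reduceCyclically.reduce_flatten_replicate_succ (isReduced_toWord (x := x)) 1
  have hc := reduceCyclically.conj_conjugator_reduceCyclically x.toWord
  have hne : reduceCyclically x.toWord ≠ [] := by
    intro h0
    rw [h0] at hc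
    apply hx
    rw [← mk_toWord (x := x), ← hc, List.append_nil, ← mul_mk, ← inv_mk, mul_inv_cancel]
  have h2 : (x * x).toWord = reduceCyclically.conjugator x.toWord ++
      (reduceCyclically x.toWord ++ reduceCyclically x.toWord) ++
      invRev (reduceCyclically.conjugator x.toWord) := by
    rw [toWord_mul]; simpa using h
  have hpos := List.length_pos_iff.2 hne
  rw [FreeGroup.norm, FreeGroup.norm, h2]
  conv_lhs => rw [← hc]
  simp only [List.length_append]
  omega

theorem two_mul_cancellation_inv_lt {x : FreeGroup α} (hx : x ≠ 1) :
    2 * cancellation x⁻¹ x < norm x := by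
  have h := norm_inv_mul x⁻¹ x
  rw [inv_inv, norm_inv_eq] at h
  have := norm_lt_norm_mul_self hx
  omega

end CommonPrefix

/-! ### Nielsen-reduced families -/

section NielsenReduced

variable {α ι : Type*} [DecidableEq α]

/-- The value of a letter, or of its inverse, under an assignment of the letters. -/
def letterValue {G : Type*} [Group G] (f : ι → G) (s : ι × Bool) : G :=
  cond s.2 (f s.1) (f s.1)⁻¹

theorem letterValue_flip {G : Type*} [Group G] (f : ι → G) (s : ι × Bool) :
    letterValue f (s.1, !s.2) = (letterValue f s)⁻¹ := by
  rcases s with ⟨i, _ | _⟩ <;> simp [letterValue]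

/-- Nielsen's conditions: no letter is lost in a product of two or three letters. -/
structure IsNielsenReduced (f : ι → FreeGroup α) : Prop where
  ne_one : ∀ i, f i ≠ 1
  two_mul_cancellation_le : ∀ s t, s ≠ t →
    2 * cancellation (letterValue f s) (letterValue f t) ≤ norm (letterValue f s)
  cancellation_add_lt : ∀ s t r, s ≠ t → r ≠ (t.1, !t.2) →
    cancellation (letterValue f s) (letterValue f t) +
      cancellation (letterValue f t)⁻¹ (letterValue f r) < norm (letterValue f t)

/-- Part of the first factor survives in the product, so any other letter `s` shares with the
product at most what it shares with `t`. The two bounds feed each other in the induction: limited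
overlap makes each new factor increase the length. -/
theorem IsNielsenReduced.prod_aux {f : ι → FreeGroup α} (hf : IsNielsenReduced f)
    (t : ι × Bool) (L : List (ι × Bool)) (hL : IsReduced (t :: L)) :
    (∀ s, s ≠ t → cancellation (letterValue f s) ((t :: L).map (letterValue f)).prod ≤
      cancellation (letterValue f s) (letterValue f t)) ∧
    (∀ s, s ≠ t → cancellation (letterValue f s) (letterValue f t) + (L.length + 1) ≤
      norm ((t :: L).map (letterValue f)).prod) := by
  induction L generalizing t with
  | nil =>
    refine ⟨by simp, fun s hs => ?_⟩
    have h1 := hf.two_mul_cancellation_le t s hs.symm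
    rw [cancellation_comm] at h1
    have h2 : 0 < norm (letterValue f t) := by
      rw [Nat.pos_iff_ne_zero, Ne, FreeGroup.norm_eq_zero]
      have := hf.ne_one t.1
      rcases t with ⟨i, _ | _⟩ <;> simpa [letterValue] using this
    simp
    omega
  | cons r L ih =>
    rw [isReduced_cons_cons] at hL
    obtain ⟨ih1, ih2⟩ := ih r hL.2
    have hr : (t.1, !t.2) ≠ r := by
      rintro rfl
      simpa using hL.1
    have h1 := ih1 _ hr
    have h2 := ih2 _ hr
    rw [letterValue_flip] at h1 h2
    rw [List.map_cons, List.prod_cons]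
    set π := ((r :: L).map (letterValue f)).prod
    have h3 := norm_inv_mul (letterValue f t)⁻¹ π
    rw [inv_inv, norm_inv_eq] at h3
    have h4 := norm_inv_mul (letterValue f t) (letterValue f t * π)
    rw [inv_mul_cancel_left] at h4
    refine ⟨fun s hs => ?_, fun s hs => ?_⟩
    · have h5 := hf.cancellation_add_lt s t r hs hr.symm
      have h6 := min_cancellation_le (letterValue f s) (letterValue f t * π) (letterValue f t)
      rw [cancellation_comm _ (letterValue f t)] at h6
      omega
    · have h5 := hf.cancellation_add_lt s t r hs hr.symm
      simp only [List.length_cons]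
      omega

theorem IsNielsenReduced.length_le_norm {f : ι → FreeGroup α}
    (hf : IsNielsenReduced f) (L : List (ι × Bool)) (hL : IsReduced L) :
    L.length ≤ norm (L.map (letterValue f)).prod := by
  cases L with
  | nil => simp
  | cons t L =>
    have := (hf.prod_aux t L hL).2 (t.1, !t.2) (by intro h; simpa using congrArg Prod.snd h)
    simp only [List.length_cons]
    omega

/-- A reduced product of `n` letters has norm at least `n`, while a free generator has norm 1; so it
is a single letter. -/
theorem IsNielsenReduced.exists_letter [DecidableEq ι] {f : ι → FreeGroup α}
    (hf : IsNielsenReduced f) (hgen : Subgroup.closure (Set.range f) = ⊤) (i : α) :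
    ∃ s, letterValue f s = of i := by
  have hi : of i ∈ (FreeGroup.lift f).range := by
    rw [FreeGroup.range_lift_eq_closure, hgen]; trivial
  obtain ⟨x, hx⟩ := hi
  have hx' : (x.toWord.map (letterValue f)).prod = of i := by
    rw [← hx]
    conv_rhs => rw [← mk_toWord (x := x), FreeGroup.lift_mk]
    rfl
  have h := hf.length_le_norm x.toWord isReduced_toWord
  rw [hx', norm_of] at h
  match hw : x.toWord with
  | [] =>
    rw [hw] at hx'
    exact absurd hx'.symm (of_ne_one i)
  | [s] => exact ⟨s, by rw [hw] at hx'; simpa using hx'⟩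
  | _ :: _ :: _ => rw [hw] at h; simp at h

end NielsenReduced

/-! ### Nielsen's theorem in rank two -/

section NielsenInduction

/-- Closure of a property of pairs under the elementary Nielsen moves and simultaneous
conjugation. -/
structure NielsenClosed {G : Type*} [Group G] (p : G → G → Prop) : Prop where
  swap : ∀ {u v}, p u v → p v u
  inv_left : ∀ {u v}, p u v → p u⁻¹ v
  mul_right : ∀ {u v}, p u v → p u (u * v)
  conj : ∀ {u v} (g), p u v → p (g * u * g⁻¹) (g * v * g⁻¹)

namespace NielsenClosed

variable {G : Type*} [Group G] {p : G → G → Prop} (hp : NielsenClosed p)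
include hp

theorem swap_iff {u v : G} : p v u ↔ p u v := ⟨hp.swap, hp.swap⟩

theorem inv_left_iff {u v : G} : p u⁻¹ v ↔ p u v :=
  ⟨fun h => by simpa using hp.inv_left h, hp.inv_left⟩

theorem inv_right_iff {u v : G} : p u v⁻¹ ↔ p u v := by
  rw [← hp.swap_iff, hp.inv_left_iff, hp.swap_iff]

theorem mul_right_iff {u v : G} : p u (u * v) ↔ p u v := by
  refine ⟨fun h => ?_, hp.mul_right⟩
  have := hp.mul_right (hp.inv_left h)
  rwa [inv_mul_cancel_left, hp.inv_left_iff] at this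

theorem inv_mul_left_iff {u v : G} : p (u⁻¹ * v) v ↔ p u v := by
  rw [← hp.inv_left_iff, mul_inv_rev, inv_inv, ← hp.swap_iff, ← hp.inv_left_iff, hp.mul_right_iff,
    hp.inv_left_iff, hp.swap_iff]

theorem conj_iff {u v g : G} : p (g * u * g⁻¹) (g * v * g⁻¹) ↔ p u v := by
  refine ⟨fun h => ?_, hp.conj g⟩
  simpa [mul_assoc] using hp.conj g⁻¹ h

theorem letterValue_iff (f : Fin 2 → G) (s t : Fin 2 × Bool) (hst : s.1 ≠ t.1) :
    p (letterValue f s) (letterValue f t) ↔ p (f 0) (f 1) := by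
  rcases s with ⟨i, σ⟩
  rcases t with ⟨j, τ⟩
  have h : p (f i) (f j) ↔ p (f 0) (f 1) := by
    fin_cases i <;> fin_cases j <;> first | exact absurd rfl hst | exact Iff.rfl | exact hp.swap_iff
  rw [← h]
  cases σ <;> cases τ <;> simp [letterValue, hp.inv_left_iff, hp.inv_right_iff]

end NielsenClosed

/-- The reduced word of `x` begins with the first half `p` of `y` and ends with its second half
`q⁻¹`; `m` is what lies between. -/
theorem exists_eq_mul_of_cancellation {α : Type*} [DecidableEq α] {x y : FreeGroup α} {k : ℕ}
    (hy : FreeGroup.norm y = 2 * k) (hx : 2 * k ≤ FreeGroup.norm x) (h₁ : k ≤ cancellation x y)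
    (h₂ : k ≤ cancellation y⁻¹ x⁻¹) :
    ∃ p m q : FreeGroup α, y = p * q⁻¹ ∧ x = p * m * q⁻¹ ∧
      FreeGroup.norm (q⁻¹ * p) ≤ 2 * k ∧ FreeGroup.norm m ≤ FreeGroup.norm x - 2 * k := by
  obtain ⟨-, -, h₁⟩ := (le_commonPrefixLength_iff _ _ _).1 h₁
  obtain ⟨-, -, h₂⟩ := (le_commonPrefixLength_iff _ _ _).1 h₂
  have hY := List.take_append_drop k y.toWord
  have hX := List.take_append_drop k x.toWord
  rw [h₁] at hX
  unfold FreeGroup.norm at hy hx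
  have lX : (x.toWord.drop k).length = x.toWord.length - k := List.length_drop
  have lY : (y.toWord.drop k).length = k := by rw [List.length_drop]; omega
  have lP : (y.toWord.take k).length = k := by rw [List.length_take]; omega
  set P := y.toWord.take k
  set X' := x.toWord.drop k
  set Y' := y.toWord.drop k
  rw [toWord_inv, toWord_inv, ← hX, ← hY, invRev_append, invRev_append,
    List.take_append_of_le_length (by rw [invRev_length]; omega),
    List.take_append_of_le_length (by rw [invRev_length]; omega),
    List.take_of_length_le (by rw [invRev_length]; omega)] at h₂
  have hM := List.take_append_drop k (invRev X')
  rw [← h₂] at hM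
  have hX'' : X' = invRev ((invRev X').drop k) ++ Y' := by
    rw [← invRev_invRev (L₁ := Y'), ← invRev_append, hM, invRev_invRev]
  have lM : (invRev ((invRev X').drop k)).length = x.toWord.length - 2 * k := by
    rw [invRev_length, List.length_drop, invRev_length]; omega
  refine ⟨mk P, mk (invRev ((invRev X').drop k)), (mk Y')⁻¹, ?_, ?_, ?_, ?_⟩
  · rw [inv_inv, mul_mk, hY, mk_toWord]
  · rw [inv_inv, mul_mk, mul_mk, List.append_assoc, ← hX'', hX, mk_toWord]
  · rw [inv_inv, mul_mk]
    refine norm_mk_le.trans ?_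
    rw [List.length_append]; omega
  · refine norm_mk_le.trans ?_
    rw [lM, FreeGroup.norm]

/-- The third alternative is the tie where `t` is entirely cancelled, half from each side. In rank
two it can be resolved by a simultaneous conjugation that lowers the total length, so no ordering of
words of equal length is needed. -/
theorem isNielsenReduced_or_exists_shorter {α : Type*} [DecidableEq α] (f : Fin 2 → FreeGroup α)
    (hf : ∀ i, f i ≠ 1) :
    IsNielsenReduced f ∨
    (∃ s t : Fin 2 × Bool, s.1 ≠ t.1 ∧
      FreeGroup.norm ((letterValue f s)⁻¹ * letterValue f t) <
        FreeGroup.norm (letterValue f s)) ∨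
    (∃ s t : Fin 2 × Bool, s.1 ≠ t.1 ∧ ∃ p m q : FreeGroup α,
      letterValue f t = p * q⁻¹ ∧ letterValue f s = p * m * q⁻¹ ∧
      FreeGroup.norm (q⁻¹ * p) ≤ FreeGroup.norm (letterValue f t) ∧
      FreeGroup.norm m < FreeGroup.norm (letterValue f s)) := by
  rw [or_iff_not_imp_right, not_or]
  rintro ⟨hA, hB⟩
  push Not at hA hB
  have hne : ∀ s, letterValue f s ≠ 1 := by
    rintro ⟨i, _ | _⟩ <;> simpa [letterValue] using hf i
  have hflip : ∀ s t : Fin 2 × Bool, s.1 = t.1 → s ≠ t → s = (t.1, !t.2) := by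
    rintro ⟨i, σ⟩ ⟨j, τ⟩ h hne
    dsimp at h
    subst h
    cases σ <;> cases τ <;> simp at hne ⊢
  have hthird : ∀ i j k : Fin 2, i ≠ j → k ≠ j → i = k := by decide
  have N1 : ∀ s t, s ≠ t →
      2 * cancellation (letterValue f s) (letterValue f t) ≤
        FreeGroup.norm (letterValue f s) := by
    intro s t hst
    by_cases h : s.1 = t.1
    · rw [hflip s t h hst, letterValue_flip, norm_inv_eq]
      exact (two_mul_cancellation_inv_lt (hne t)).le
    · have h1 := hA t s (Ne.symm h)
      have h2 := norm_inv_mul (letterValue f t) (letterValue f s)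
      rw [cancellation_comm] at h2
      omega
  refine ⟨hf, N1, fun s t r hs hr => ?_⟩
  by_contra hcon
  have h1 := N1 t s hs.symm
  have h2 := N1 _ _ hr.symm
  rw [letterValue_flip, norm_inv_eq] at h2
  rw [cancellation_comm] at h1
  obtain ⟨k, hk⟩ : ∃ k, k = cancellation (letterValue f s) (letterValue f t) := ⟨_, rfl⟩
  have hk1 : cancellation (letterValue f t)⁻¹ (letterValue f r) = k := by omega
  have hk2 : FreeGroup.norm (letterValue f t) = 2 * k := by omega
  have hst : s.1 ≠ t.1 := by
    intro h
    have h3 := two_mul_cancellation_inv_lt (hne t)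
    rw [hflip s t h hs, letterValue_flip] at hk
    omega
  have hrt : r.1 ≠ t.1 := by
    intro h
    have h3 := two_mul_cancellation_inv_lt (hne t)
    have : r = t := by
      by_contra hrt
      exact hr (hflip r t h hrt)
    rw [this] at hk1
    omega
  -- If `r = s`, then `t` and `t⁻¹` would both share a prefix of length `k` with `s`, hence with
  -- each other, which is too much cancellation in a square.
  have hrs : r = (s.1, !s.2) := by
    refine hflip r s (hthird _ _ _ hrt hst) ?_
    rintro rfl
    have h3 := two_mul_cancellation_inv_lt (hne t)
    have h4 := min_cancellation_le (letterValue f t)⁻¹ (letterValue f r) (letterValue f t)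
    omega
  rw [hrs, letterValue_flip] at hk1
  have h5 := N1 s t hs
  have hpos : 0 < FreeGroup.norm (letterValue f t) :=
    Nat.pos_of_ne_zero (by rw [Ne, FreeGroup.norm_eq_zero]; exact hne t)
  have h6 : 2 * k ≤ FreeGroup.norm (letterValue f s) := by omega
  obtain ⟨p, m, q, e1, e2, e3, e4⟩ :=
    exists_eq_mul_of_cancellation hk2 h6 hk.le hk1.ge
  have := hB s t hst p m q e1 e2 (by omega)
  omega

theorem nielsenClosed_closure {G : Type*} [Group G] :
    NielsenClosed fun u v : G => Subgroup.closure {u, v} = ⊤ := by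
  have key : ∀ {u v u' v' : G}, Subgroup.closure {u, v} = ⊤ →
      u ∈ Subgroup.closure {u', v'} → v ∈ Subgroup.closure {u', v'} →
      Subgroup.closure {u', v'} = ⊤ := by
    intro u v u' v' h hu hv
    rw [← top_le_iff, ← h, Subgroup.closure_le]
    rintro x (rfl | rfl) <;> assumption
  refine ⟨fun {u v} h => ?_, fun {u v} h => ?_, fun {u v} h => ?_, fun {u v} g h => ?_⟩
  · rwa [Set.pair_comm]
  · refine key h ?_ (Subgroup.subset_closure (by simp))
    rw [← inv_mem_iff]
    exact Subgroup.subset_closure (by simp)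
  · refine key h (Subgroup.subset_closure (by simp)) ?_
    have hu : u ∈ Subgroup.closure {u, u * v} := Subgroup.subset_closure (by simp)
    have hv : u * v ∈ Subgroup.closure {u, u * v} := Subgroup.subset_closure (by simp)
    simpa using mul_mem (inv_mem hu) hv
  · have := congrArg (Subgroup.map (MulAut.conj g).toMonoidHom) h
    rw [MonoidHom.map_closure, Set.image_pair,
      Subgroup.map_top_of_surjective _ (MulAut.conj g).surjective] at this
    simpa using this

theorem a_ne_letter_b : a ≠ b ∧ a ≠ b⁻¹ := by
  unfold a b; decide

theorem ne_one_of_isGeneratorPair {u v : F2} (h : IsGeneratorPair u v) : u ≠ 1 := by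
  rintro rfl
  have h' : Subgroup.zpowers v = ⊤ := by
    rw [← top_le_iff, ← (h : Subgroup.closure _ = ⊤), Subgroup.closure_le]
    rintro x (rfl | rfl)
    · exact one_mem _
    · exact Subgroup.mem_zpowers x
  have ha : a ∈ Subgroup.zpowers v := h' ▸ Subgroup.mem_top a
  have hb : b ∈ Subgroup.zpowers v := h' ▸ Subgroup.mem_top b
  obtain ⟨m, hm⟩ := ha
  obtain ⟨n, hn⟩ := hb
  have hc : a * b = b * a := by
    rw [← hm, ← hn]
    exact (Commute.refl v).zpow_zpow m n
  revert hc
  unfold a b; decide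

/-- Nielsen's theorem in rank two, as an induction principle for generator pairs. -/
theorem IsGeneratorPair.induction {p : F2 → F2 → Prop} (hp : NielsenClosed p) (hab : p a b)
    {u v : F2} (h : IsGeneratorPair u v) : p u v := by
  suffices H : ∀ (n : ℕ) (f : Fin 2 → F2), IsGeneratorPair (f 0) (f 1) →
      FreeGroup.norm (f 0) + FreeGroup.norm (f 1) = n → p (f 0) (f 1) from
    H _ ![u, v] h rfl
  intro n
  induction n using Nat.strong_induction_on with
  | _ n ih =>
  intro f hf hn
  have hc : NielsenClosed IsGeneratorPair := nielsenClosed_closure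
  have hsum : ∀ s t : Fin 2 × Bool, s.1 ≠ t.1 →
      FreeGroup.norm (letterValue f s) + FreeGroup.norm (letterValue f t) = n := by
    have hnorm : ∀ i σ, FreeGroup.norm (letterValue f (i, σ)) = FreeGroup.norm (f i) := by
      intro i σ; cases σ <;> simp [letterValue]
    rintro ⟨i, σ⟩ ⟨j, τ⟩ hst
    rw [hnorm, hnorm]
    fin_cases i <;> fin_cases j <;> simp at hst ⊢ <;> omega
  have hne : ∀ i, f i ≠ 1 := by
    intro i
    fin_cases i
    · exact ne_one_of_isGeneratorPair hf
    · exact ne_one_of_isGeneratorPair (hc.swap hf)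
  rcases isNielsenReduced_or_exists_shorter f hne with hred | ⟨s, t, hst, hlt⟩ |
    ⟨s, t, hst, x, m, y, e1, e2, e3, e4⟩
  · have hgen : Subgroup.closure (Set.range f) = ⊤ := by
      rw [← (hf : Subgroup.closure _ = ⊤)]
      congr 1
      ext x
      simp [eq_comm]
    obtain ⟨s, hs⟩ := hred.exists_letter hgen 0
    obtain ⟨t, ht⟩ := hred.exists_letter hgen 1
    have hst : s.1 ≠ t.1 := by
      intro hst
      have hab : a = b ∨ a = b⁻¹ := by
        rcases s with ⟨i, σ⟩
        rcases t with ⟨j, τ⟩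
        dsimp at hst
        subst hst
        unfold a b
        rw [← hs, ← ht]
        cases σ <;> cases τ <;> simp [letterValue]
      exact hab.elim a_ne_letter_b.1 a_ne_letter_b.2
    rw [← hp.letterValue_iff f s t hst, hs, ht]
    exact hab
  · rw [← hp.letterValue_iff f s t hst, ← hp.inv_mul_left_iff]
    refine ih _ ?_ ![_, _] ?_ rfl
    · have := hsum s t hst
      change FreeGroup.norm (_⁻¹ * _) + FreeGroup.norm (letterValue f t) < n
      omega
    · exact hc.inv_mul_left_iff.2 ((hc.letterValue_iff f s t hst).2 hf)
  -- With `t = x * y⁻¹` and `s = x * m * y⁻¹`, one has `s * t⁻¹ = x * m * x⁻¹` and `t = x * (y⁻¹ *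
  -- x) * x⁻¹`: up to Nielsen moves the pair is conjugate to `(m, y⁻¹ * x)`.
  · have key : ∀ {q : F2 → F2 → Prop}, NielsenClosed q →
        (q m (y⁻¹ * x) ↔ q (f 0) (f 1)) := by
      intro q hq
      rw [← hq.letterValue_iff f s t hst, e1, e2, ← hq.inv_left_iff, ← hq.inv_mul_left_iff,
        ← hq.conj_iff (g := x)]
      simp [mul_assoc]
    rw [← key hp]
    refine ih _ ?_ ![_, _] ?_ rfl
    · have := hsum s t hst
      change FreeGroup.norm m + FreeGroup.norm (y⁻¹ * x) < n
      omega
    · exact (key hc).2 hf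

end NielsenInduction

/-! ### Word reversal and palindromes -/

section Reversal

variable {α : Type*}

/-- The anti-automorphism of a free group that fixes the free generators. -/
def rev (w : FreeGroup α) : FreeGroup α := (FreeGroup.lift (fun i => (of i)⁻¹) w)⁻¹

theorem rev_mul (u v : FreeGroup α) : rev (u * v) = rev v * rev u := by simp [rev]

theorem rev_one : rev (1 : FreeGroup α) = 1 := by simp [rev]

theorem rev_inv (u : FreeGroup α) : rev u⁻¹ = (rev u)⁻¹ := by simp [rev]

theorem rev_of (i : α) : rev (of i) = of i := by simp [rev]

theorem rev_mk (L : List (α × Bool)) : rev (mk L) = mk L.reverse := by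
  induction L with
  | nil => exact rev_one
  | cons x xs ih =>
    have hx : rev (mk [x]) = mk [x] := by
      rcases x with ⟨i, _ | _⟩
      · change rev (of i)⁻¹ = (of i)⁻¹
        rw [rev_inv, rev_of]
      · exact rev_of i
    rw [← List.singleton_append, ← mul_mk, rev_mul, ih, hx, mul_mk]
    simp

theorem rev_rev (u : FreeGroup α) : rev (rev u) = u := by
  rcases u with ⟨L⟩
  change rev (rev (mk L)) = mk L
  rw [rev_mk, rev_mk, List.reverse_reverse]

theorem isReduced_reverse {L : List (α × Bool)} (h : FreeGroup.IsReduced L) :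
    FreeGroup.IsReduced L.reverse := by
  refine List.isChain_reverse.2 (List.IsChain.imp ?_ h)
  intro p q hpq e
  exact (hpq e.symm).symm

theorem isCyclicallyReduced_of_reverse_eq {L : List (α × Bool)} (hL : FreeGroup.IsReduced L)
    (h : L.reverse = L) : IsCyclicallyReduced L := by
  refine ⟨hL, fun p hp q hq _ => ?_⟩
  rw [← h, List.getLast?_reverse] at hp
  rw [Option.mem_unique hp hq]

variable [DecidableEq α]

theorem toWord_rev (w : FreeGroup α) : (rev w).toWord = w.toWord.reverse := by
  conv_lhs => rw [← mk_toWord (x := w), rev_mk, toWord_mk]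
  exact (isReduced_reverse isReduced_toWord).reduce_eq

theorem rev_eq_self_iff (w : FreeGroup α) : rev w = w ↔ w.toWord.reverse = w.toWord := by
  rw [← toWord_rev, toWord_inj]

/-- Inversion reverses the word and flips every sign, so equality with the plain reversal leaves no
letters. -/
theorem eq_one_of_rev_eq_inv {w : FreeGroup α} (h : rev w = w⁻¹) : w = 1 := by
  rw [← toWord_inj, toWord_rev, toWord_inv, invRev, List.reverse_inj] at h
  rw [← toWord_eq_nil_iff]
  match hw : w.toWord with
  | [] => rfl
  | x :: xs =>
    rw [hw] at h
    have h' := congrArg Prod.snd (List.cons.inj h).1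
    simp at h'

theorem mk_inj_of_isReduced {L₁ L₂ : List (α × Bool)} (h₁ : FreeGroup.IsReduced L₁)
    (h₂ : FreeGroup.IsReduced L₂) (h : mk L₁ = mk L₂) : L₁ = L₂ := by
  rw [← h₁.reduce_eq, ← h₂.reduce_eq, ← toWord_mk, ← toWord_mk, h]

/-- Suppose the word is `x M x⁻¹`. If `c ≠ x`, both sides are reduced as written and their first
letters `x` and `c` differ. If `c = x`, cancelling leaves `c M = M.reverse c`, so `M` is empty or
ends in `c`, and the following `c⁻¹` contradicts reducedness. -/
theorem isCyclicallyReduced_of_mul_eq {w : FreeGroup α} (c : α × Bool)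
    (h : w * mk [c] = mk [c] * rev w) : IsCyclicallyReduced w.toWord := by
  have hred := isReduced_toWord (x := w)
  rw [← mk_toWord (x := w), rev_mk] at h
  generalize w.toWord = L at h hred
  induction L using List.bidirectionalRec with
  | nil => simp
  | singleton x => simp
  | cons_append x M y _ =>
    rw [← List.cons_append] at *
    rw [isCyclicallyReduced_cons_append_iff]
    refine ⟨hred, ?_⟩
    intro he
    by_contra hne
    have hy : [y] = invRev [x] := by
      simp only [invRev, List.map_cons, List.map_nil, List.reverse_singleton, List.cons.injEq,
        and_true]
      ext
      · exact he
      · revert hne; cases x.2 <;> cases y.2 <;> simp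
    have hrev := isReduced_reverse hred
    by_cases hc : c = x
    · subst hc
      have h1 : mk (c :: M) = mk (M.reverse ++ [c]) := by
        rw [List.reverse_append, List.reverse_singleton, ← mul_mk, ← mul_mk, hy, ← inv_mk,
          inv_mul_cancel_right, mul_inv_cancel_left, List.reverse_cons] at h
        exact h
      have r1 : FreeGroup.IsReduced (c :: M) := hred.infix ⟨[], [y], by simp⟩
      have r2 : FreeGroup.IsReduced (M.reverse ++ [c]) := by
        have := isReduced_reverse r1
        simpa using this
      have h2 := mk_inj_of_isReduced r1 r2 h1
      rcases List.eq_nil_or_concat' M with rfl | ⟨M', z, rfl⟩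
      · simp at hred
        exact hne (hred he.symm).symm
      · have h3 : z = c := by
          have := congrArg List.getLast? h2
          rw [← List.cons_append, List.getLast?_concat, List.getLast?_concat] at this
          exact Option.some.inj this
        subst h3
        have r3 : FreeGroup.IsReduced [z, y] := hred.infix ⟨z :: M', [], by simp⟩
        simp at r3
        exact hne (r3 he.symm).symm
    · have r1 : FreeGroup.IsReduced ([y] ++ [c]) := by
        simp
        intro h1
        by_contra h2
        apply hc
        ext
        · exact h1.symm.trans he
        · revert hne h2; cases x.2 <;> cases y.2 <;> cases c.2 <;> simp
      have r2 : FreeGroup.IsReduced (x :: M ++ [y] ++ [c]) :=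
        IsReduced.append_overlap hred r1 (by simp)
      have r3 : FreeGroup.IsReduced ([c] ++ (x :: M ++ [y]).reverse) := by
        have := IsReduced.append_overlap (L₁ := [c]) (L₂ := [y]) (L₃ := (x :: M).reverse)
          (by simpa using isReduced_reverse r1) (by simpa using hrev) (by simp)
        simpa using this
      rw [mul_mk, mul_mk] at h
      have := mk_inj_of_isReduced r2 r3 h
      simp at this
      exact hc this.1.symm

end Reversal

/-! ### Exponent sums, parities and the determinant -/

section ExponentSums

theorem expSum_mul (i : Fin 2) (u v : F2) : expSum i (u * v) = expSum i u + expSum i v := by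
  simp [expSum]

theorem expSum_inv (i : Fin 2) (u : F2) : expSum i u⁻¹ = -expSum i u := by
  simp [expSum]

theorem expSum_zpow (i : Fin 2) (u : F2) (n : ℤ) : expSum i (u ^ n) = n * expSum i u := by
  simp [expSum]

theorem expSum_one (i : Fin 2) : expSum i 1 = 0 := by simp [expSum]

theorem expSum_conj (i : Fin 2) (g u : F2) : expSum i (g * u * g⁻¹) = expSum i u := by
  rw [expSum_mul, expSum_mul, expSum_inv]; ring

theorem expSum_rev (i : Fin 2) (u : F2) : expSum i (rev u) = expSum i u := by
  have h : ((FreeGroup.lift (fun j : Fin 2 =>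
      Multiplicative.ofAdd (if j = i then (1 : ℤ) else 0))).comp
      (FreeGroup.lift (fun j : Fin 2 => (of j)⁻¹))) u =
      ((FreeGroup.lift (fun j : Fin 2 =>
      Multiplicative.ofAdd (if j = i then (1 : ℤ) else 0))) u)⁻¹ := by
    rw [← MonoidHom.inv_apply]
    congr 1
    ext j
    simp
  rw [rev, expSum_inv]
  have := congrArg Multiplicative.toAdd h
  rw [toAdd_inv] at this
  simp only [expSum]
  rw [← neg_eq_iff_eq_neg.2 this]
  rfl

/-- The exponent sums of `b` and `a`, reduced mod 2. -/
def expParity (u : F2) : ZMod 2 × ZMod 2 := ((expSum 1 u : ZMod 2), (expSum 0 u : ZMod 2))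

theorem expParity_mul (u v : F2) : expParity (u * v) = expParity u + expParity v := by
  simp [expParity, expSum_mul]

theorem neg_parity (x : ZMod 2 × ZMod 2) : -x = x := by revert x; decide

theorem expParity_inv (u : F2) : expParity u⁻¹ = expParity u := by
  rw [← neg_parity (expParity u)]; simp [expParity, expSum_inv]

theorem expParity_rev (u : F2) : expParity (rev u) = expParity u := by
  simp [expParity, expSum_rev]

theorem expParity_conj (g u : F2) : expParity (g * u * g⁻¹) = expParity u := by
  simp [expParity, expSum_conj]

theorem expParity_one : expParity 1 = 0 := by simp [expParity, expSum_one]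

theorem expParity_a : expParity a = (0, 1) := by simp [expParity, expSum, a]

theorem expParity_b : expParity b = (1, 0) := by simp [expParity, expSum, b]

/-- The determinant of the exponent sum vectors of two elements. -/
def expDet (u v : F2) : ℤ := expSum 0 u * expSum 1 v - expSum 1 u * expSum 0 v

theorem isUnit_expDet {u v : F2} (h : IsGeneratorPair u v) : IsUnit (expDet u v) := by
  refine IsGeneratorPair.induction (p := fun u v => IsUnit (expDet u v)) ⟨?_, ?_, ?_, ?_⟩ ?_ h
  · intro u v h
    have : expDet v u = -expDet u v := by unfold expDet; ring
    rw [this]; exact h.neg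
  · intro u v h
    have : expDet u⁻¹ v = -expDet u v := by unfold expDet; rw [expSum_inv, expSum_inv]; ring
    rw [this]; exact h.neg
  · intro u v h
    have : expDet u (u * v) = expDet u v := by unfold expDet; rw [expSum_mul, expSum_mul]; ring
    rwa [this]
  · intro u v g h
    simpa only [expDet, expSum_conj] using h
  · simp [expDet, expSum, a, b]

end ExponentSums

/-! ### Existence of palindromic conjugates -/

section Existence

/-- The condition says that `w ↦ g * rev w * g⁻¹` fixes `u` and `v`. The clause `rev g = g` lets `g`
be split symmetrically, and the parity clause identifies its middle. -/
theorem exists_reversing_element {u v : F2} (h : IsGeneratorPair u v) :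
    ∃ g, rev g = g ∧ u * g = g * rev u ∧ v * g = g * rev v ∧
      expParity g = (1, 1) + expParity u + expParity v := by
  refine IsGeneratorPair.induction (p := fun u v => ∃ g, rev g = g ∧ u * g = g * rev u ∧
    v * g = g * rev v ∧ expParity g = (1, 1) + expParity u + expParity v) ⟨?_, ?_, ?_, ?_⟩ ?_ h
  · rintro u v ⟨g, h1, h2, h3, h4⟩
    exact ⟨g, h1, h3, h2, by rw [h4, add_right_comm]⟩
  · rintro u v ⟨g, h1, h2, h3, h4⟩
    refine ⟨g, h1, ?_, h3, by rw [h4, expParity_inv]⟩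
    rw [rev_inv, inv_mul_eq_iff_eq_mul, ← mul_assoc, h2, mul_inv_cancel_right]
  · rintro u v ⟨g, h1, h2, h3, h4⟩
    -- The map fixing `u` and `v` sends `u * v` to `v * u`; a further conjugation by `u` restores `u
    -- * v` and still fixes `u`.
    refine ⟨u * g, ?_, ?_, ?_, ?_⟩
    · rw [rev_mul, h1, h2]
    · rw [mul_assoc, ← h2]
    · calc u * v * (u * g) = u * (v * g) * rev u := by rw [h2]; group
        _ = u * g * rev (u * v) := by rw [h3, rev_mul]; group
    · rw [expParity_mul, expParity_mul, h4]
      generalize expParity u = x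
      generalize expParity v = y
      revert x y
      decide
  · rintro u v k ⟨g, h1, h2, h3, h4⟩
    have key : ∀ w, w * g = g * rev w →
        k * w * k⁻¹ * (k * g * rev k) = k * g * rev k * rev (k * w * k⁻¹) := by
      intro w hw
      rw [rev_mul, rev_mul, rev_inv]
      calc _ = k * (w * g) * rev k := by group
        _ = _ := by rw [hw]; group
    refine ⟨k * g * rev k, ?_, key u h2, key v h3, ?_⟩
    · rw [rev_mul, rev_mul, rev_rev, h1, mul_assoc]
    · rw [expParity_mul, expParity_mul, expParity_rev, expParity_conj, expParity_conj, h4]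
      generalize expParity u = x
      generalize expParity v = y
      generalize expParity k = z
      revert x y z
      decide
  · refine ⟨1, rev_one, by simp [a, rev_of], by simp [b, rev_of], ?_⟩
    rw [expParity_one, expParity_a, expParity_b]
    decide

/-- The middle letter of the palindromes that reverse the elements of the basic pair. -/
def middle : Mod2Type → Mod2Type → F2
  | .zeroOne, .oneOne => a
  | .oneOne, .zeroOne => a
  | .oneZero, .oneOne => b⁻¹
  | .oneOne, .oneZero => b⁻¹
  | _, _ => 1

theorem middle_eq (η η' : Mod2Type) :
    middle η η' = 1 ∨ middle η η' = a ∨ middle η η' = b⁻¹ := by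
  cases η <;> cases η' <;> simp [middle]

theorem exists_eq_mul_middle {g : F2} (hg : rev g = g) :
    ∃ h m : F2, (m = 1 ∨ m = a ∨ m = b⁻¹) ∧ g = h * m * rev h := by
  have hp : List.Palindrome g.toWord := List.Palindrome.of_reverse_eq ((rev_eq_self_iff g).1 hg)
  rw [← mk_toWord (x := g)]
  generalize g.toWord = L at hp
  induction hp with
  | nil => exact ⟨1, 1, Or.inl rfl, by rw [rev_one]; rfl⟩
  | singleton x =>
    rcases x with ⟨i, σ⟩
    fin_cases i <;> cases σ
    -- A central letter of the wrong sign is absorbed: `a⁻¹ = a⁻¹ * a * a⁻¹`, and likewise `b = b *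
    -- b⁻¹ * b` below. This leaves one middle per parity.
    · refine ⟨a⁻¹, a, by simp, ?_⟩
      rw [rev_inv, a, rev_of]
      change (of 0)⁻¹ = _
      group
    · exact ⟨1, a, by simp, by rw [rev_one]; rfl⟩
    · exact ⟨1, b⁻¹, by simp, by rw [rev_one]; rfl⟩
    · refine ⟨b, b⁻¹, by simp, ?_⟩
      rw [b, rev_of]
      change of 1 = _
      group
  | cons_concat x _ ih =>
    obtain ⟨h, m, hm, e⟩ := ih
    refine ⟨mk [x] * h, m, hm, ?_⟩
    rw [← List.singleton_append, ← mul_mk, ← mul_mk, e, rev_mul, rev_mk]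
    simp only [List.reverse_singleton]
    group

theorem exists_conj_mul_middle_eq {η η' : Mod2Type} (hne : η ≠ η') {u v : F2}
    (h : IsGeneratorPair u v) (hu : HasType u η) (hv : HasType v η') :
    ∃ g : F2, (g * u * g⁻¹) * middle η η' = middle η η' * rev (g * u * g⁻¹) ∧
      (g * v * g⁻¹) * middle η η' = middle η η' * rev (g * v * g⁻¹) := by
  obtain ⟨g, h1, h2, h3, h4⟩ := exists_reversing_element h
  obtain ⟨k, m, hm, rfl⟩ := exists_eq_mul_middle h1
  have hu' : expParity u = η.residues := hu
  have hv' : expParity v = η'.residues := hv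
  have hmid : m = middle η η' := by
    rw [hu', hv', expParity_mul, expParity_mul, expParity_rev] at h4
    -- `h * m * rev h` has the parity of `m`, since `h` and `rev h` contribute equally mod 2.
    have h5 : expParity m = (1, 1) + η.residues + η'.residues := by
      rw [← h4]
      generalize expParity m = x
      generalize expParity k = y
      revert x y
      decide
    clear h h1 h2 h3 h4 hu hv hu' hv'
    rcases hm with rfl | rfl | rfl <;>
    simp only [expParity_one, expParity_a, expParity_b, expParity_inv] at h5 <;>
    cases η <;> cases η' <;> first | rfl | exact absurd rfl hne | (revert h5; decide)
  rw [← hmid]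
  have key : ∀ w, w * (k * m * rev k) = k * m * rev k * rev w →
      k⁻¹ * w * k⁻¹⁻¹ * m = m * rev (k⁻¹ * w * k⁻¹⁻¹) := by
    intro w hw
    rw [rev_mul, rev_mul, inv_inv, rev_inv]
    calc _ = k⁻¹ * (w * (k * m * rev k)) * (rev k)⁻¹ := by group
      _ = _ := by rw [hw]; group
  exact ⟨k⁻¹, key u h2, key v h3⟩

end Existence

/-! ### Centralizers of primitive elements -/

section Centralizers

/-- By Nielsen–Schreier the subgroup generated by `x` and `y` is free; being abelian, it has rank at
most one and is cyclic. -/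
theorem exists_zpow_of_commute {α : Type*} {x y : FreeGroup α} (h : x * y = y * x) :
    ∃ (t : FreeGroup α) (m n : ℤ), x = t ^ m ∧ y = t ^ n := by
  classical
  let H : Subgroup (FreeGroup α) := Subgroup.closure {x, y}
  have hcomm : ∀ p q : H, p * q = q * p := by
    have := Subgroup.isMulCommutative_closure (k := {x, y}) (by
      rintro p (rfl | rfl) q (rfl | rfl) <;> first | rfl | exact h | exact h.symm)
    exact fun p q => mul_comm' p q
  have e := IsFreeGroup.toFreeGroup H
  have hsub : Subsingleton (IsFreeGroup.Generators H) := by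
    refine ⟨fun i j => ?_⟩
    have h1 : of i * of j = of j * of i := by
      apply e.symm.injective
      rw [_root_.map_mul, _root_.map_mul, hcomm]
    have h2 := congrArg toWord h1
    by_contra hij
    rw [toWord_mul, toWord_mul] at h2
    simp [hij, Ne.symm hij] at h2
  have hcyc : ∃ t : H, ∀ p : H, ∃ n : ℤ, p = t ^ n := by
    rcases isEmpty_or_nonempty (IsFreeGroup.Generators H) with he | ⟨⟨i⟩⟩
    · refine ⟨1, fun p => ⟨0, e.injective (Subsingleton.elim _ _)⟩⟩
    · have : Unique (IsFreeGroup.Generators H) := ⟨⟨i⟩, fun j => Subsingleton.elim _ _⟩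
      obtain ⟨g, hg⟩ := IsCyclic.exists_generator (α := FreeGroup (IsFreeGroup.Generators H))
      refine ⟨e.symm g, fun p => ?_⟩
      obtain ⟨n, hn⟩ := hg (e p)
      refine ⟨n, e.injective ?_⟩
      simpa using hn.symm
  obtain ⟨t, ht⟩ := hcyc
  obtain ⟨m, hm⟩ := ht ⟨x, Subgroup.subset_closure (by simp)⟩
  obtain ⟨n, hn⟩ := ht ⟨y, Subgroup.subset_closure (by simp)⟩
  exact ⟨t, m, n, by simpa using congrArg Subtype.val hm, by simpa using congrArg Subtype.val hn⟩

/-- If `u = t ^ m`, then `m` divides the unit `expDet u v`, so `m = ±1` and `t` is itself a power of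
`u`. -/
theorem IsPrimitive.exists_zpow_of_commute {u c : F2} (hu : IsPrimitive u) (h : u * c = c * u) :
    ∃ n : ℤ, c = u ^ n := by
  obtain ⟨v, hv⟩ := hu
  obtain ⟨t, m, n, rfl, rfl⟩ := PalindromicPrimitives.exists_zpow_of_commute h
  have h1 := isUnit_expDet hv
  have h2 : expDet (t ^ m) v = m * expDet t v := by
    unfold expDet; rw [expSum_zpow, expSum_zpow]; ring
  rw [h2] at h1
  rcases Int.isUnit_iff.1 (isUnit_of_mul_isUnit_left h1) with rfl | rfl
  · exact ⟨n, by rw [zpow_one]⟩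
  · exact ⟨-n, by rw [← zpow_mul]; simp⟩

end Centralizers

/-! ### Palindromes in basic pairs as a twisted reversal identity -/

section PalindromesInBasicPairs

theorem exists_inverse_evalIn_basicPair {η η' : Mod2Type} (h : η ≠ η') :
    ∃ ψ : F2 →* FreeGroup (Fin 2), (∀ x, ψ (evalIn (basicPair η η') x) = x) ∧
      ∀ w, evalIn (basicPair η η') (ψ w) = w := by
  have key : ∀ A B : FreeGroup (Fin 2),
      evalIn (basicPair η η') A = a → evalIn (basicPair η η') B = b →
      FreeGroup.lift ![A, B] η.generator = of 0 → FreeGroup.lift ![A, B] η'.generator = of 1 →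
      ∃ ψ : F2 →* FreeGroup (Fin 2), (∀ x, ψ (evalIn (basicPair η η') x) = x) ∧
      ∀ w, evalIn (basicPair η η') (ψ w) = w := by
    intro A B hA hB h0 h1
    refine ⟨FreeGroup.lift ![A, B], DFunLike.congr_fun (f := (FreeGroup.lift ![A, B]).comp
      (evalIn (basicPair η η'))) (g := MonoidHom.id _) ?_,
      DFunLike.congr_fun (f := (evalIn (basicPair η η')).comp
      (FreeGroup.lift ![A, B])) (g := MonoidHom.id _) ?_⟩
    · ext i
      fin_cases i
      · simpa [evalIn, basicPair] using h0
      · simpa [evalIn, basicPair] using h1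
    · ext i
      fin_cases i
      · simpa [a] using hA
      · simpa [b] using hB
  cases η <;> cases η' <;> first | exact absurd rfl h | skip
  · apply key (of 0) (of 1) <;> simp [evalIn, basicPair, Mod2Type.generator, a, b]
  · apply key (of 0) ((of 0)⁻¹ * of 1) <;> simp [evalIn, basicPair, Mod2Type.generator, a, b]
  · apply key (of 1) (of 0) <;> simp [evalIn, basicPair, Mod2Type.generator, a, b]
  · apply key (of 1 * (of 0)⁻¹) (of 0) <;> simp [evalIn, basicPair, Mod2Type.generator, a, b]
  · apply key (of 1) ((of 1)⁻¹ * of 0) <;> simp [evalIn, basicPair, Mod2Type.generator, a, b]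
  · apply key (of 0 * (of 1)⁻¹) (of 1) <;> simp [evalIn, basicPair, Mod2Type.generator, a, b]

/-- Both sides come from anti-automorphisms, so it suffices to check the two basic generators, e.g.
`(a * b) * a = a * (b * a)` for the pair `(a, ab)`. -/
theorem evalIn_basicPair_rev {η η' : Mod2Type} (h : η ≠ η') (x : FreeGroup (Fin 2)) :
    evalIn (basicPair η η') x * middle η η' =
      middle η η' * rev (evalIn (basicPair η η') (rev x)) := by
  have hgen : ∀ i, evalIn (basicPair η η') (of i) * middle η η' =
      middle η η' * rev (evalIn (basicPair η η') (of i)) := by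
    intro i
    fin_cases i <;> cases η <;> cases η' <;> first | exact absurd rfl h | skip
    all_goals
      simp [evalIn, basicPair, Mod2Type.generator, middle, a, b, rev_mul, rev_of, mul_assoc]
  induction x using FreeGroup.induction_on with
  | C1 => simp [rev_one]
  | of i => rw [rev_of]; exact hgen i
  | inv_of i _ =>
    rw [rev_inv, rev_of, _root_.map_inv, rev_inv, inv_mul_eq_iff_eq_mul, ← mul_assoc, hgen i,
      mul_inv_cancel_right]
  | mul x y hx hy =>
    rw [rev_mul, _root_.map_mul, _root_.map_mul, rev_mul, mul_assoc, hy, ← mul_assoc, hx, mul_assoc]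

theorem isPalindromicIn_basicPair_iff {η η' : Mod2Type} (h : η ≠ η') (w : F2) :
    IsPalindromicIn (basicPair η η') w ↔ w * middle η η' = middle η η' * rev w := by
  obtain ⟨ψ, hψ, hψ'⟩ := exists_inverse_evalIn_basicPair h
  constructor
  · rintro ⟨x, rfl, hx⟩
    rw [evalIn_basicPair_rev h, (rev_eq_self_iff x).2 hx]
  · intro hw
    refine ⟨ψ w, hψ' w, (rev_eq_self_iff _).1 ?_⟩
    have h1 := evalIn_basicPair_rev h (ψ w)
    rw [hψ', hw, mul_right_inj] at h1
    have h2 := congrArg rev h1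
    rw [rev_rev, rev_rev] at h2
    rw [← hψ (rev (ψ w)), ← h2]

theorem IsPalindromicIn.inv {P : F2 × F2} {w : F2} (h : IsPalindromicIn P w) :
    IsPalindromicIn P w⁻¹ := by
  obtain ⟨x, rfl, hx⟩ := h
  refine ⟨x⁻¹, _root_.map_inv _ _, ?_⟩
  rw [← rev_eq_self_iff] at hx ⊢
  rw [rev_inv, hx]

theorem IsPalindromicIn.isCyclicallyShortestIn_self {P : F2 × F2} {w : F2}
    (h : IsPalindromicIn P w) : IsCyclicallyShortestIn P w := by
  obtain ⟨x, hw, hx⟩ := h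
  exact ⟨x, hw, isCyclicallyReduced_of_reverse_eq isReduced_toWord hx⟩

theorem IsPalindromicIn.isCyclicallyShortestIn_standardPair {η η' : Mod2Type} (h : η ≠ η') {w : F2}
    (hw : IsPalindromicIn (basicPair η η') w) : IsCyclicallyShortestIn standardPair w := by
  rw [isPalindromicIn_basicPair_iff h] at hw
  refine ⟨w, ?_, ?_⟩
  · have : evalIn standardPair = MonoidHom.id F2 := by
      ext i
      fin_cases i <;> simp [evalIn, standardPair, a, b]
    rw [this]
    rfl
  · rcases middle_eq η η' with hm | hm | hm <;> rw [hm] at hw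
    · rw [mul_one, one_mul] at hw
      exact isCyclicallyReduced_of_reverse_eq isReduced_toWord ((rev_eq_self_iff w).1 hw.symm)
    · exact isCyclicallyReduced_of_mul_eq (0, true) hw
    · exact isCyclicallyReduced_of_mul_eq (1, false) hw

theorem IsPalindromicIn.isCyclicallyShortestIn {η η' : Mod2Type} (h : η ≠ η') {w : F2}
    (hw : IsPalindromicIn (basicPair η η') w) {P : F2 × F2}
    (hP : P = standardPair ∨ P = basicPair η η') : IsCyclicallyShortestIn P w := by
  rcases hP with rfl | rfl
  · exact hw.isCyclicallyShortestIn_standardPair h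
  · exact hw.isCyclicallyShortestIn_self

end PalindromesInBasicPairs

/-! ### Uniqueness up to inversion -/

section Uniqueness

theorem HasType.exists_odd_expSum {u : F2} {η : Mod2Type} (h : HasType u η) :
    ∃ i, Odd (expSum i u) := by
  by_contra hcon
  push Not at hcon
  have h0 : ∀ i, (expSum i u : ZMod 2) = 0 := fun i => by
    rw [ZMod.intCast_zmod_eq_zero_iff_dvd]
    exact (Int.not_odd_iff_even.1 (hcon i)).two_dvd
  rw [HasType, h0, h0] at h
  revert h
  cases η <;> decide

theorem conj_eq_of_isPalindromicIn {η η' : Mod2Type} (h : η ≠ η') {u k : F2}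
    (hu : IsPrimitive u) {τ : Mod2Type} (hτ : HasType u τ)
    (h₁ : IsPalindromicIn (basicPair η η') u)
    (h₂ : IsPalindromicIn (basicPair η η') (k * u * k⁻¹)) : k * u * k⁻¹ = u := by
  obtain ⟨ψ, hψ, hψ'⟩ := exists_inverse_evalIn_basicPair h
  have hinj : Function.Injective (evalIn (basicPair η η')) := Function.LeftInverse.injective hψ
  obtain ⟨y, rfl⟩ : ∃ y, evalIn (basicPair η η') y = k := ⟨ψ k, hψ' k⟩
  obtain ⟨x, rfl, hx⟩ := h₁
  obtain ⟨z, hz, hz'⟩ := h₂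
  rw [← _root_.map_inv, ← _root_.map_mul, ← _root_.map_mul] at hz
  rw [hinj hz, ← rev_eq_self_iff] at hz'
  rw [← rev_eq_self_iff] at hx
  rw [rev_mul, rev_mul, rev_inv, hx] at hz'
  have hcomm : x * (rev y * y) = rev y * y * x := by
    calc x * (rev y * y) = rev y * ((rev y)⁻¹ * (x * rev y)) * y := by group
      _ = rev y * y * x := by rw [hz']; group
  obtain ⟨n, hn⟩ := hu.exists_zpow_of_commute (c := evalIn (basicPair η η') (rev y * y))
    (by rw [← _root_.map_mul, hcomm, _root_.map_mul])
  have hsum : ∀ i, expSum i (evalIn (basicPair η η') (rev y)) =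
      expSum i (evalIn (basicPair η η') y) := by
    intro i
    have := congrArg (expSum i) (evalIn_basicPair_rev h y)
    rw [expSum_mul, expSum_mul, expSum_rev] at this
    omega
  obtain ⟨i, hi⟩ := hτ.exists_odd_expSum
  have hpar := congrArg (expSum i) hn
  rw [_root_.map_mul, expSum_mul, hsum, expSum_zpow] at hpar
  -- The exponent sum of `rev y * y` is twice that of `y`, while some exponent sum of `u` is odd.
  have heven : Even n := by
    by_contra hodd
    rw [Int.not_even_iff_odd] at hodd
    have := hodd.mul hi
    rw [← hpar] at this
    exact Int.not_even_iff_odd.2 this ⟨_, rfl⟩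
  obtain ⟨l, rfl⟩ := heven
  rw [← _root_.map_zpow] at hn
  have hn' := hinj hn
  have hrev : rev (y * x ^ (-l)) = (y * x ^ (-l))⁻¹ := by
    have hxl : rev (x ^ (-l)) = x ^ (-l) := by
      have hpow : ∀ j : ℕ, rev (x ^ j) = x ^ j := by
        intro j
        induction j with
        | zero => exact rev_one
        | succ j ih => rw [pow_succ, rev_mul, ih, hx, ← pow_succ', ← pow_succ]
      obtain ⟨j, hj | hj⟩ := Int.eq_nat_or_neg (-l)
      · rw [hj, zpow_natCast, hpow]
      · rw [hj, zpow_neg, zpow_natCast, rev_inv, hpow]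
    rw [eq_inv_iff_mul_eq_one, rev_mul, hxl]
    calc x ^ (-l) * rev y * (y * x ^ (-l)) = x ^ (-l) * (rev y * y) * x ^ (-l) := by group
      _ = 1 := by rw [hn']; group
  have hy := eq_one_of_rev_eq_inv hrev
  rw [zpow_neg, mul_inv_eq_one] at hy
  rw [← _root_.map_inv, ← _root_.map_mul, ← _root_.map_mul, hy]
  congr 1
  group

theorem eq_or_eq_inv_of_isPalindromicIn {η η' : Mod2Type} (h : η ≠ η') {u g k w : F2}
    (hu : IsPrimitive u) {τ : Mod2Type} (hτ : HasType u τ)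
    (h₁ : IsPalindromicIn (basicPair η η') (g * u * g⁻¹))
    (h₂ : IsPalindromicIn (basicPair η η') w) (hw : w = k * u * k⁻¹ ∨ w = k * u⁻¹ * k⁻¹) :
    w = g * u * g⁻¹ ∨ w = (g * u * g⁻¹)⁻¹ := by
  have hu' : IsPrimitive (g * u * g⁻¹) := by
    obtain ⟨v, hv⟩ := hu
    exact ⟨_, nielsenClosed_closure.conj g hv⟩
  have hτ' : HasType (g * u * g⁻¹) τ := (expParity_conj g u).trans hτ
  have key : ∀ z, IsPalindromicIn (basicPair η η') z → z = k * u * k⁻¹ → z = g * u * g⁻¹ := by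
    intro z hz e
    have e' : z = k * g⁻¹ * (g * u * g⁻¹) * (k * g⁻¹)⁻¹ := by rw [e]; group
    rw [e'] at hz ⊢
    exact conj_eq_of_isPalindromicIn h hu' hτ' h₁ hz
  rcases hw with hw | hw
  · exact Or.inl (key w h₂ hw)
  · right
    rw [← key w⁻¹ h₂.inv (by rw [hw]; group), inv_inv]

end Uniqueness

/-! ### Types of generator pairs -/

section Types

theorem intCast_expDet (u v : F2) : (expDet u v : ZMod 2) =
    (expParity u).2 * (expParity v).1 - (expParity u).1 * (expParity v).2 := by
  simp [expDet, expParity]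

theorem IsGeneratorPair.expParity_det_ne_zero {u v : F2} (h : IsGeneratorPair u v) :
    (expParity u).2 * (expParity v).1 - (expParity u).1 * (expParity v).2 ≠ 0 := by
  rw [← intCast_expDet]
  rcases Int.isUnit_iff.1 (isUnit_expDet h) with e | e <;> rw [e] <;> decide

theorem IsGeneratorPair.type_ne {u v : F2} (h : IsGeneratorPair u v) {η η' : Mod2Type}
    (hu : HasType u η) (hv : HasType v η') : η ≠ η' := by
  rintro rfl
  have h1 := h.expParity_det_ne_zero
  rw [show expParity u = η.residues from hu, show expParity v = η.residues from hv] at h1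
  revert h1
  cases η <;> decide

/-- The determinant is odd, so `v` and `u * v` realise the two types other than `η`; one of them is
`η'`. -/
theorem IsPrimitive.exists_isGeneratorPair {u : F2} (h : IsPrimitive u) {η η' : Mod2Type}
    (hu : HasType u η) (hne : η ≠ η') : ∃ v, IsGeneratorPair u v ∧ HasType v η' := by
  obtain ⟨v, hv⟩ := h
  have hu' : expParity u = η.residues := hu
  have hdet := hv.expParity_det_ne_zero
  have hcases : ∀ x y : ZMod 2 × ZMod 2, x = η.residues → x.2 * y.1 - x.1 * y.2 ≠ 0 →
      y = η'.residues ∨ x + y = η'.residues := by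
    cases η <;> cases η' <;> first | exact absurd rfl hne | decide
  rcases hcases _ _ hu' hdet with e | e
  · exact ⟨v, hv, e⟩
  · exact ⟨u * v, nielsenClosed_closure.mul_right hv, (expParity_mul u v).trans e⟩

end Types

end PalindromicPrimitives

open PalindromicPrimitives in
/-- `P` is the pair with respect to which "cyclically shortest" is understood: it may be either
`(a, b)` or the basic pair of type `(η, η')`. -/
theorem proposition2p1 :
    (∀ (η η' : Mod2Type) (u : F2), IsPrimitive u → HasType u η → η' ≠ η →
      ∀ P : F2 × F2, P = standardPair ∨ P = basicPair η η' →
        ∃ u' : F2, (∃ g : F2, u' = g * u * g⁻¹) ∧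
          IsCyclicallyShortestIn P u' ∧ IsPalindromicIn (basicPair η η') u' ∧
          ∀ w : F2, (∃ g : F2, w = g * u * g⁻¹ ∨ w = g * u⁻¹ * g⁻¹) →
            IsCyclicallyShortestIn P w → IsPalindromicIn (basicPair η η') w →
            w = u' ∨ w = u'⁻¹) ∧
    (∀ (η η' : Mod2Type) (u v : F2), IsGeneratorPair u v → HasType u η → HasType v η' →
      ∀ P : F2 × F2, P = standardPair ∨ P = basicPair η η' →
        ∃ u' v' : F2, (∃ g : F2, u' = g * u * g⁻¹ ∧ v' = g * v * g⁻¹) ∧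
          (IsCyclicallyShortestIn P u' ∧ IsCyclicallyShortestIn P v') ∧
          (IsPalindromicIn (basicPair η η') u' ∧ IsPalindromicIn (basicPair η η') v') ∧
          ∀ w z : F2, (∃ g : F2, (w = g * u * g⁻¹ ∨ w = g * u⁻¹ * g⁻¹) ∧
              (z = g * v * g⁻¹ ∨ z = g * v⁻¹ * g⁻¹)) →
            IsCyclicallyShortestIn P w → IsCyclicallyShortestIn P z →
            IsPalindromicIn (basicPair η η') w → IsPalindromicIn (basicPair η η') z →
            (w = u' ∨ w = u'⁻¹) ∧ (z = v' ∨ z = v'⁻¹)) := by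
  have exist : ∀ {η η' : Mod2Type} {u v : F2}, η ≠ η' → IsGeneratorPair u v → HasType u η →
      HasType v η' → ∃ g : F2, IsPalindromicIn (basicPair η η') (g * u * g⁻¹) ∧
        IsPalindromicIn (basicPair η η') (g * v * g⁻¹) := by
    intro η η' u v hne h hu hv
    obtain ⟨g, h1, h2⟩ := exists_conj_mul_middle_eq hne h hu hv
    exact ⟨g, (isPalindromicIn_basicPair_iff hne _).2 h1,
      (isPalindromicIn_basicPair_iff hne _).2 h2⟩
  refine ⟨fun η η' u hu hη hne P hP => ?_, fun η η' u v huv hu hv P hP => ?_⟩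
  · obtain ⟨v, hv, hη'⟩ := hu.exists_isGeneratorPair hη hne.symm
    obtain ⟨g, hg, -⟩ := exist hne.symm hv hη hη'
    refine ⟨_, ⟨g, rfl⟩, hg.isCyclicallyShortestIn hne.symm hP, hg, ?_⟩
    rintro w ⟨k, hk⟩ - hw
    exact eq_or_eq_inv_of_isPalindromicIn hne.symm hu hη hg hw hk
  · have hne := huv.type_ne hu hv
    obtain ⟨g, hg, hg'⟩ := exist hne huv hu hv
    refine ⟨_, _, ⟨g, rfl, rfl⟩, ⟨hg.isCyclicallyShortestIn hne hP,
      hg'.isCyclicallyShortestIn hne hP⟩, ⟨hg, hg'⟩, ?_⟩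
    rintro w z ⟨k, hk, hk'⟩ - - hw hz
    exact ⟨eq_or_eq_inv_of_isPalindromicIn hne ⟨v, huv⟩ hu hg hw hk,
      eq_or_eq_inv_of_isPalindromicIn hne ⟨u, nielsenClosed_closure.swap huv⟩ hv hg' hz hk'⟩
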